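/- Consider the tiling of the plane by closed unit equilateral triangles (the triangular lattice). A \emph{polyiamond} is a nonempty finite set of these triangles (its tiles) that is connected under the relation of sharing an entire edge. A \emph{hole} of a polyiamond is a bounded connected component of the complement in the plane of the union of its closed tiles. For $h\ge 1$ let $g_\triangle(h)$ denote the minimum number of tiles of a polyiamond with exactly $h$ holes. For every integer $k>1$ put $$h_k=3\binom{k}{2}=\tfrac32k^2-\tfrac32k,\qquad n_k=\tfrac12\,(9k^2+3k-4)=\tfrac92k^2+\tfrac32k-2 .$$ Then $g_\triangle(h_k)=n_k$; that is, there is a polyiamond with exactly $h_k$ holes and $n_k$ tiles, and every polyiamond with exactly $h_k$ holes has at least $n_k$ tiles. -/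

import Mathlib

/-- The Euclidean plane. -/
abbrev Plane : Type := EuclideanSpace ℝ (Fin 2)

/-- The point of the triangular lattice (of side length one) with integer coordinates `v`
with respect to the basis `(1, 0)`, `(1/2, √3/2)`. -/
noncomputable def latticePoint (v : ℤ × ℤ) : Plane :=
  !₂[(v.1 : ℝ) + (v.2 : ℝ) / 2, (v.2 : ℝ) * (Real.sqrt 3 / 2)]

/-- A tile, that is a unit equilateral triangle of the triangular lattice: `⟨i, j, true⟩` is the
up-triangle and `⟨i, j, false⟩` the down-triangle of the rhombus with lower left corner
`(i, j)`. -/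
structure Tile where
  i : ℤ
  j : ℤ
  up : Bool
deriving DecidableEq

/-- The three vertices of a tile, in lattice coordinates. -/
def Tile.vertices (t : Tile) : Finset (ℤ × ℤ) :=
  if t.up then {(t.i, t.j), (t.i + 1, t.j), (t.i, t.j + 1)}
  else {(t.i + 1, t.j), (t.i, t.j + 1), (t.i + 1, t.j + 1)}

/-- The closed triangle in the plane that a tile occupies. -/
noncomputable def Tile.region (t : Tile) : Set Plane :=
  convexHull ℝ (latticePoint '' (t.vertices : Set (ℤ × ℤ)))

/-- The adjacency of tiles: two tiles are adjacent if they have an entire edge, that is exactly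
two vertices, in common. -/
def tileGraph : SimpleGraph Tile where
  Adj s t := (s.vertices ∩ t.vertices).card = 2
  symm := ⟨fun s t h => by rwa [Finset.inter_comm]⟩
  loopless := ⟨fun t h => by
    rw [Finset.inter_self] at h
    cases hb : t.up <;> simp [Tile.vertices, hb] at h⟩

/-- A polyiamond: a nonempty finite set of tiles that are glued together along entire edges, that
is, whose dual graph is connected. -/
def IsPolyiamond (A : Finset Tile) : Prop :=
  (tileGraph.induce (A : Set Tile)).Connected

/-- The planar shape of a finite set of tiles: the union of the closed tiles. -/
noncomputable def shape (A : Finset Tile) : Set Plane :=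
  ⋃ t ∈ A, t.region

/-- The holes: the bounded connected components of the complement of the shape in the plane. -/
def holes (A : Finset Tile) : Set (Set Plane) :=
  {C | (∃ x ∈ (shape A)ᶜ, C = connectedComponentIn (shape A)ᶜ x) ∧ Bornology.IsBounded C}

/-- The numbers of tiles of the polyiamonds with exactly `h` holes. -/
def tileCounts (h : ℕ) : Set ℕ :=
  {n | ∃ A : Finset Tile, IsPolyiamond A ∧ (holes A).encard = h ∧ A.card = n}

/-! Lower bound. Let a polyiamond have `n` tiles and `h` holes. Its dual graph is connected, so it
has at least `n - 1` internal edges and hence at most `n + 2` boundary edges (`card_boundary_le`).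
Each hole is surrounded by at least three of them. Filling the holes leaves a set of at least `n +
h` tiles whose perimeter `p` satisfies `3 * h + p ≤ n + 2`, and the isoperimetric inequality of the
triangular lattice gives `6 * (n + h) ≤ p ^ 2 + 3` (`six_mul_card_le`). For `h = 3 * k.choose 2`
these two inequalities exclude every `n` below the claimed value.

The isoperimetric inequality comes from counting strips. Every occupied strip, in each of the three
directions, has two ends on the boundary, so the perimeter is at least the number of occupied
strips. Up- and down-triangles correspond to zero-sum triples of strip coordinates, and their number
is bounded by `twelve_mul_card_zeroSumTriples_le`.

Construction. Hexagons of perimeter `6 * m` with `6 * m ^ 2 - 2` tiles are nested. From the ring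
around the `m`-th one every other tile along its perimeter is removed, which makes `3 * m`
single-tile holes; over `1 ≤ m < k` this gives `3 * k.choose 2`. The rest stays connected, ring by
ring. That there are no further holes needs no geometry: the two inequalities of the lower bound
rule them out.

Topology enters only in translating holes into sets of tiles (`exists_inequality_of_subset_holes`)
and isolated missing tiles into holes (`exists_finset_subset_holes`). -/

namespace Tile

/-! ### Strip coordinates and adjacency of tiles -/

/-- The three strip coordinates of a tile. They add up to `0` for an up-triangle and to `-1` for a
down-triangle. -/
def coord (d : Fin 3) (t : Tile) : ℤ :=
  match d with
  | 0 => t.i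
  | 1 => t.j
  | 2 => if t.up then -(t.i + t.j) else -(t.i + t.j) - 1

/-- The neighbour of a tile that lies in another strip in direction `d`. -/
def nbr (d : Fin 3) (t : Tile) : Tile :=
  match d with
  | 0 => ⟨if t.up then t.i - 1 else t.i + 1, t.j, !t.up⟩
  | 1 => ⟨t.i, if t.up then t.j - 1 else t.j + 1, !t.up⟩
  | 2 => ⟨t.i, t.j, !t.up⟩

theorem coord_sum (t : Tile) :
    coord 0 t + coord 1 t + coord 2 t = if t.up then 0 else -1 := by
  cases h : t.up <;> simp [coord, h]
  ring

theorem eq_of_coord_eq {s t : Tile} (h : ∀ d, coord d s = coord d t) : s = t := by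
  obtain ⟨i, j, u⟩ := s
  obtain ⟨i', j', u'⟩ := t
  have h0 := h 0
  have h1 := h 1
  have h2 := h 2
  simp only [coord] at h0 h1 h2
  subst h0 h1
  cases u <;> cases u' <;> simp at h2 ⊢
  all_goals omega

theorem up_nbr (d : Fin 3) (t : Tile) : (nbr d t).up = !t.up := by
  fin_cases d <;> rfl

theorem coord_nbr_self (d : Fin 3) (t : Tile) :
    coord d (nbr d t) = if t.up then coord d t - 1 else coord d t + 1 := by
  obtain ⟨i, j, u⟩ := t
  fin_cases d <;> cases u <;> simp [coord, nbr]

theorem coord_nbr_of_ne {d e : Fin 3} (h : e ≠ d) (t : Tile) : coord e (nbr d t) = coord e t := by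
  obtain ⟨i, j, u⟩ := t
  fin_cases d <;> fin_cases e <;> cases u <;> simp [coord, nbr] at h ⊢
  all_goals ring

@[simp]
theorem nbr_nbr (d : Fin 3) (t : Tile) : nbr d (nbr d t) = t := by
  obtain ⟨i, j, u⟩ := t
  fin_cases d <;> cases u <;> simp [nbr]

theorem nbr_injective_left (t : Tile) : Function.Injective fun d => nbr d t := by
  intro d e h
  by_contra hne
  have h1 := coord_nbr_self d t
  have h2 := coord_nbr_of_ne hne t
  simp only at h
  rw [h, h2] at h1
  split_ifs at h1 <;> omega

theorem adj_iff {s t : Tile} : tileGraph.Adj s t ↔ ∃ d, nbr d s = t := by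
  constructor
  · intro h
    have h' : (s.vertices ∩ t.vertices).card = 2 := h
    have hne : s ≠ t := h.ne
    obtain ⟨⟨a, b⟩, ha, ⟨c, d⟩, hc, hab⟩ :=
      Finset.one_lt_card.1 (show 1 < (s.vertices ∩ t.vertices).card by omega)
    obtain ⟨i, j, u⟩ := s
    obtain ⟨i', j', u'⟩ := t
    rw [Finset.mem_inter] at ha hc
    obtain ⟨ha, ha'⟩ := ha
    obtain ⟨hc, hc'⟩ := hc
    have key : (u = true ∧ u' = false ∧ ((i' = i - 1 ∧ j' = j) ∨ (i' = i ∧ j' = j - 1) ∨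
        (i' = i ∧ j' = j))) ∨ (u = false ∧ u' = true ∧ ((i' = i + 1 ∧ j' = j) ∨
        (i' = i ∧ j' = j + 1) ∨ (i' = i ∧ j' = j))) := by
      cases u <;> cases u' <;> simp [vertices] at ha ha' hc hc' hab hne ⊢ <;> omega
    rcases key with ⟨rfl, rfl, h | h | h⟩ | ⟨rfl, rfl, h | h | h⟩ <;> obtain ⟨rfl, rfl⟩ := h
    exacts [⟨0, rfl⟩, ⟨1, rfl⟩, ⟨2, rfl⟩, ⟨0, rfl⟩, ⟨1, rfl⟩, ⟨2, rfl⟩]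
  · rintro ⟨d, rfl⟩
    -- Up-triangles suffice: `nbr d` is an involution that exchanges the two orientations.
    have hup : ∀ (d : Fin 3) (i j : ℤ),
        ((⟨i, j, true⟩ : Tile).vertices ∩ (nbr d ⟨i, j, true⟩).vertices).card = 2 := by
      intro d i j
      rw [Finset.card_eq_two]
      fin_cases d
      · refine ⟨(i, j), (i, j + 1), by simp, ?_⟩
        ext ⟨a, b⟩
        simp [vertices, nbr]
      · refine ⟨(i, j), (i + 1, j), by simp, ?_⟩
        ext ⟨a, b⟩
        simp [vertices, nbr]
      · refine ⟨(i, j + 1), (i + 1, j), by simp, ?_⟩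
        ext ⟨a, b⟩
        simp [vertices, nbr]
        omega
    cases hu : s.up
    · refine tileGraph.symm.symm _ _ ?_
      have h := hup d (nbr d s).i (nbr d s).j
      have e : (⟨(nbr d s).i, (nbr d s).j, true⟩ : Tile) = nbr d s := by
        have : (nbr d s).up = true := by rw [up_nbr, hu]; rfl
        rw [← this]
      rw [e, nbr_nbr] at h
      exact h
    · have h := hup d s.i s.j
      have e : (⟨s.i, s.j, true⟩ : Tile) = s := by rw [← hu]
      rw [e] at h
      exact h

end Tile

/-! ### Counting zero-sum triples -/

/-- The triples in `X × Y × Z` with sum zero. -/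
def zeroSumTriples (X Y Z : Finset ℤ) : Finset (ℤ × ℤ × ℤ) :=
  (X ×ˢ Y ×ˢ Z).filter fun p => p.1 + p.2.1 + p.2.2 = 0

theorem card_zeroSumTriples_rotate (X Y Z : Finset ℤ) :
    (zeroSumTriples X Y Z).card = (zeroSumTriples Y Z X).card := by
  refine Finset.card_nbij' (fun p => (p.2.1, p.2.2, p.1)) (fun p => (p.2.2, p.1, p.2.1))
    ?_ ?_ (fun _ _ => rfl) (fun _ _ => rfl)
  all_goals
    rintro ⟨x, y, z⟩ h
    simp only [zeroSumTriples, Finset.coe_filter, Finset.mem_product, Set.mem_ofPred_eq] at h ⊢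
    refine ⟨by tauto, by omega⟩

/-- For a given `z` at most one triple is lost: if `M + y = x + m` with `x ≤ M` and `m ≤ y`, then `x
= M` and `y = m`. -/
theorem card_zeroSumTriples_le_add {X Y : Finset ℤ} (hX : X.Nonempty) (hY : Y.Nonempty)
    (Z : Finset ℤ) :
    (zeroSumTriples X Y Z).card ≤
      (zeroSumTriples (X.erase (X.max' hX)) (Y.erase (Y.min' hY)) Z).card + Z.card := by
  classical
  set M := X.max' hX with hM
  set m := Y.min' hY with hm
  have hsub : zeroSumTriples X Y Z ⊆ zeroSumTriples (X.erase M) (Y.erase m) Z ∪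
      (zeroSumTriples X Y Z).filter fun p => p.1 = M ∨ p.2.1 = m := by
    rintro ⟨x, y, z⟩ h
    simp only [zeroSumTriples, Finset.mem_union, Finset.mem_filter, Finset.mem_product,
      Finset.mem_erase] at h ⊢
    tauto
  refine (Finset.card_le_card hsub).trans ((Finset.card_union_le _ _).trans ?_)
  refine Nat.add_le_add_left (Finset.card_le_card_of_injOn (fun p => p.2.2) ?_ ?_) _
  · rintro ⟨x, y, z⟩ h
    simp only [zeroSumTriples, Finset.coe_filter, Finset.mem_filter, Finset.mem_product,
      Set.mem_ofPred_eq] at h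
    exact h.1.1.2.2
  · rintro ⟨x, y, z⟩ h ⟨x', y', z'⟩ h' hz
    simp only [zeroSumTriples, Finset.coe_filter, Finset.mem_filter, Finset.mem_product,
      Set.mem_ofPred_eq] at h h' hz
    have h1 := X.le_max' x h.1.1.1
    have h2 := X.le_max' x' h'.1.1.1
    have h3 := Y.min'_le y h.1.1.2.1
    have h4 := Y.min'_le y' h'.1.1.2.1
    simp only [Prod.mk.injEq]
    omega

/-- A discrete isoperimetric inequality: sets of integers of given sizes have few triples of sum
zero. -/
theorem twelve_mul_card_zeroSumTriples_le (X Y Z : Finset ℤ) :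
    12 * (zeroSumTriples X Y Z).card ≤ (X.card + Y.card + Z.card) ^ 2 + 3 := by
  suffices H : ∀ n, ∀ X Y Z : Finset ℤ, X.card + Y.card + Z.card = n →
      12 * (zeroSumTriples X Y Z).card ≤ n ^ 2 + 3 from H _ X Y Z rfl
  intro n
  induction n using Nat.strong_induction_on with
  | _ n ih =>
  have main : ∀ X Y Z : Finset ℤ, X.card + Y.card + Z.card = n → Z.card ≤ X.card →
      Z.card ≤ Y.card → 12 * (zeroSumTriples X Y Z).card ≤ n ^ 2 + 3 := by
    intro X Y Z hn hX hY
    rcases Nat.eq_zero_or_pos Z.card with h0 | hpos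
    · rw [Finset.card_eq_zero] at h0
      simp [zeroSumTriples, h0]
    have hXn : X.Nonempty := Finset.card_pos.1 (by omega)
    have hYn : Y.Nonempty := Finset.card_pos.1 (by omega)
    have step := card_zeroSumTriples_le_add hXn hYn Z
    have hXe := Finset.card_erase_of_mem (X.max'_mem hXn)
    have hYe := Finset.card_erase_of_mem (Y.min'_mem hYn)
    have ih' := ih (n - 2) (by omega) (X.erase (X.max' hXn)) (Y.erase (Y.min' hYn)) Z (by omega)
    generalize (zeroSumTriples (X.erase (X.max' hXn)) (Y.erase (Y.min' hYn)) Z).card = N' at *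
    generalize (zeroSumTriples X Y Z).card = N at *
    generalize Z.card = c at *
    obtain ⟨m, rfl⟩ : ∃ m, n = m + 2 := ⟨n - 2, by omega⟩
    rw [Nat.add_sub_cancel] at ih'
    -- The induction adds `12 * c`, which `n ^ 2 - (n - 2) ^ 2 = 4 * n - 4` absorbs unless all three
    -- sets have the same size `c`. In that case the estimate is `9 * c ^ 2 + 7`, too large by 4,
    -- and divisibility of the left side by 12 makes up the difference.
    by_cases hc : 3 * c ≤ m + 1
    · nlinarith
    · have hm : m + 2 = 3 * c := by omega
      rcases Nat.even_or_odd' c with ⟨r, rfl | rfl⟩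
      · obtain ⟨s, rfl⟩ : ∃ s, r = s + 1 := ⟨r - 1, by omega⟩
        have : m = 6 * s + 4 := by omega
        subst this
        ring_nf at ih' ⊢
        omega
      · have : m = 6 * r + 1 := by omega
        subst this
        ring_nf at ih' ⊢
        omega
  intro X Y Z hn
  by_cases h1 : Z.card ≤ X.card ∧ Z.card ≤ Y.card
  · exact main X Y Z hn h1.1 h1.2
  by_cases h2 : X.card ≤ Y.card ∧ X.card ≤ Z.card
  · rw [card_zeroSumTriples_rotate]
    exact main Y Z X (by omega) h2.1 h2.2
  · rw [card_zeroSumTriples_rotate, card_zeroSumTriples_rotate]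
    exact main Z X Y (by omega) (by omega) (by omega)

/-! ### Perimeter and isoperimetric inequality for sets of tiles -/

namespace Tile

/-- The boundary edges of a finite set of tiles, as pairs of a tile of the set and a direction in
which its neighbour does not belong to the set. -/
def boundary (B : Finset Tile) : Finset (Tile × Fin 3) :=
  (B ×ˢ Finset.univ).filter fun p => nbr p.2 p.1 ∉ B

theorem mem_boundary {B : Finset Tile} {p : Tile × Fin 3} :
    p ∈ boundary B ↔ p.1 ∈ B ∧ nbr p.2 p.1 ∉ B := by
  simp [boundary]

/-- Counts one end of each occupied strip. Moving along a strip towards larger `coord f - coord e`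
crosses an `e`-edge from an up-triangle and an `f`-edge from a down-triangle, so the last tile in
`B` has that edge on the boundary. Exchanging `e` and `f` gives the other end. -/
theorem card_image_coord_le (B : Finset Tile) {d e f : Fin 3} (hde : d ≠ e) (hdf : d ≠ f)
    (hef : e ≠ f) :
    (B.image (coord d)).card ≤ (B.filter fun t => t.up = true ∧ nbr e t ∉ B).card +
      (B.filter fun t => t.up = false ∧ nbr f t ∉ B).card := by
  have hsub : B.image (coord d) ⊆ (B.filter fun t => t.up = true ∧ nbr e t ∉ B).image (coord d) ∪
      (B.filter fun t => t.up = false ∧ nbr f t ∉ B).image (coord d) := by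
    intro v hv
    obtain ⟨t₀, ht₀, hv₀⟩ := Finset.mem_image.1 hv
    obtain ⟨t, ht, hmax⟩ := Finset.exists_max_image (B.filter fun t => coord d t = v)
      (fun t => coord f t - coord e t) ⟨t₀, by simp [ht₀, hv₀]⟩
    rw [Finset.mem_filter] at ht
    rw [Finset.mem_union, Finset.mem_image, Finset.mem_image]
    cases hu : t.up
    · refine Or.inr ⟨t, Finset.mem_filter.2 ⟨ht.1, hu, fun hB => ?_⟩, ht.2⟩
      have := hmax _ (Finset.mem_filter.2 ⟨hB, by rw [coord_nbr_of_ne hdf]; exact ht.2⟩)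
      rw [coord_nbr_self, coord_nbr_of_ne hef, hu] at this
      simp at this
    · refine Or.inl ⟨t, Finset.mem_filter.2 ⟨ht.1, hu, fun hB => ?_⟩, ht.2⟩
      have := hmax _ (Finset.mem_filter.2 ⟨hB, by rw [coord_nbr_of_ne hde]; exact ht.2⟩)
      rw [coord_nbr_self, coord_nbr_of_ne hef.symm, hu] at this
      simp at this
  exact (Finset.card_le_card hsub).trans ((Finset.card_union_le _ _).trans
    (add_le_add Finset.card_image_le Finset.card_image_le))

theorem two_mul_card_image_coord_le (B : Finset Tile) {d e f : Fin 3} (hde : d ≠ e) (hdf : d ≠ f)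
    (hef : e ≠ f) :
    2 * (B.image (coord d)).card ≤
      (B.filter fun t => nbr e t ∉ B).card + (B.filter fun t => nbr f t ∉ B).card := by
  have h1 := card_image_coord_le B hde hdf hef
  have h2 := card_image_coord_le B hdf hde hef.symm
  have split : ∀ g : Fin 3, (B.filter fun t => nbr g t ∉ B).card =
      (B.filter fun t => t.up = true ∧ nbr g t ∉ B).card +
      (B.filter fun t => t.up = false ∧ nbr g t ∉ B).card := by
    intro g
    rw [← Finset.card_filter_add_card_filter_not (s := B.filter fun t => nbr g t ∉ B)
      (fun t => t.up = true), Finset.filter_filter, Finset.filter_filter]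
    simp only [and_comm, Bool.not_eq_true]
  rw [split e, split f]
  omega

theorem card_boundary (B : Finset Tile) :
    (boundary B).card = ∑ d, (B.filter fun t => nbr d t ∉ B).card := by
  rw [boundary, Finset.card_filter, Finset.sum_product_right]
  simp only [Finset.card_filter]

theorem sum_card_image_coord_le_card_boundary (B : Finset Tile) :
    (B.image (coord 0)).card + (B.image (coord 1)).card + (B.image (coord 2)).card ≤
      (boundary B).card := by
  have h0 := two_mul_card_image_coord_le B (d := 0) (e := 1) (f := 2) (by decide) (by decide)
    (by decide)
  have h1 := two_mul_card_image_coord_le B (d := 1) (e := 0) (f := 2) (by decide) (by decide)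
    (by decide)
  have h2 := two_mul_card_image_coord_le B (d := 2) (e := 0) (f := 1) (by decide) (by decide)
    (by decide)
  rw [card_boundary, Fin.sum_univ_three]
  omega

theorem three_le_card_boundary {B : Finset Tile} (hB : B.Nonempty) : 3 ≤ (boundary B).card := by
  have h := sum_card_image_coord_le_card_boundary B
  have h' : ∀ d, 0 < (B.image (coord d)).card := fun d => Finset.card_pos.2 (hB.image _)
  have h0 := h' 0
  have h1 := h' 1
  have h2 := h' 2
  omega

/-- The isoperimetric inequality for finite sets of tiles. -/
theorem six_mul_card_le (B : Finset Tile) : 6 * B.card ≤ (boundary B).card ^ 2 + 3 := by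
  set X := B.image (coord 0)
  set Y := B.image (coord 1)
  set Z := B.image (coord 2)
  have hp := sum_card_image_coord_le_card_boundary B
  have hmem : ∀ {t}, t ∈ B → coord 0 t ∈ X ∧ coord 1 t ∈ Y ∧ coord 2 t ∈ Z := fun ht =>
    ⟨Finset.mem_image_of_mem _ ht, Finset.mem_image_of_mem _ ht, Finset.mem_image_of_mem _ ht⟩
  have hup : (B.filter fun t => t.up = true).card ≤ (zeroSumTriples X Y Z).card := by
    refine Finset.card_le_card_of_injOn (fun t => (coord 0 t, coord 1 t, coord 2 t)) ?_ ?_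
    · intro t ht
      simp only [Finset.coe_filter, Set.mem_ofPred_eq] at ht
      have hs := coord_sum t
      simp only [ht.2, if_true] at hs
      obtain ⟨h0, h1, h2⟩ := hmem ht.1
      simp [zeroSumTriples, h0, h1, h2, hs]
    · intro s _ t _ hst
      simp only [Prod.mk.injEq] at hst
      refine eq_of_coord_eq fun d => ?_
      fin_cases d
      exacts [hst.1, hst.2.1, hst.2.2]
  -- The coordinates of a down-triangle add up to `-1`; shifting the last one by 1 gives a zero-sum
  -- triple without changing the number of strips.
  have hdown : (B.filter fun t => ¬ t.up = true).card ≤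
      (zeroSumTriples X Y (Z.image (· + 1))).card := by
    refine Finset.card_le_card_of_injOn (fun t => (coord 0 t, coord 1 t, coord 2 t + 1)) ?_ ?_
    · intro t ht
      simp only [Finset.coe_filter, Set.mem_ofPred_eq] at ht
      have hs := coord_sum t
      simp only [ht.2] at hs
      obtain ⟨h0, h1, h2⟩ := hmem ht.1
      simp [zeroSumTriples, h0, h1, h2]
      simp at hs
      omega
    · intro s _ t _ hst
      simp only [Prod.mk.injEq] at hst
      refine eq_of_coord_eq fun d => ?_
      fin_cases d
      exacts [hst.1, hst.2.1, by simpa using hst.2.2]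
  have hsum := Finset.card_filter_add_card_filter_not (s := B) (fun t => t.up = true)
  have h1 := twelve_mul_card_zeroSumTriples_le X Y Z
  have h2 := twelve_mul_card_zeroSumTriples_le X Y (Z.image (· + 1))
  rw [Finset.card_image_of_injective _ (add_left_injective 1)] at h2
  have h3 : (X.card + Y.card + Z.card) ^ 2 ≤ _ := Nat.pow_le_pow_left hp 2
  omega

/-- A polyiamond with `n` tiles has perimeter at most `n + 2`. -/
theorem card_boundary_le {A : Finset Tile} (hA : IsPolyiamond A) :
    (boundary A).card ≤ A.card + 2 := by
  classical
  -- A spanning tree gives at least `n - 1` internal edges. Each accounts for two of the `3 * n`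
  -- tile sides, and the other sides form the boundary.
  have hE := SimpleGraph.Connected.card_vert_le_card_edgeSet_add_one hA
  have hdeg := SimpleGraph.sum_degrees_eq_twice_card_edges (tileGraph.induce (A : Set Tile))
  have hd : ∀ t : (A : Set Tile), (tileGraph.induce (A : Set Tile)).degree t =
      (Finset.univ.filter fun d => nbr d t.1 ∈ A).card := by
    intro t
    symm
    rw [← SimpleGraph.card_neighborFinset_eq_degree]
    refine Finset.card_bij (fun d hd => ⟨nbr d t.1, (Finset.mem_filter.1 hd).2⟩) ?_ ?_ ?_
    · intro d hd
      simp [adj_iff]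
    · intro d _ e _ h
      exact nbr_injective_left t.1 (Subtype.ext_iff.1 h)
    · rintro ⟨s, hs⟩ h
      simp only [SimpleGraph.mem_neighborFinset, SimpleGraph.comap_adj,
        Function.Embedding.subtype_apply, adj_iff] at h
      obtain ⟨d, rfl⟩ := h
      exact ⟨d, by simpa using hs, rfl⟩
  simp only [hd] at hdeg
  have hsum : ∑ t : (A : Set Tile), (Finset.univ.filter fun d => nbr d t.1 ∈ A).card =
      ∑ t ∈ A, (Finset.univ.filter fun d => nbr d t ∈ A).card :=
    Finset.sum_coe_sort A fun t => (Finset.univ.filter fun d => nbr d t ∈ A).card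
  have hbd : (boundary A).card = ∑ t ∈ A, (Finset.univ.filter fun d => ¬ nbr d t ∈ A).card := by
    rw [boundary, Finset.card_filter, Finset.sum_product]
    simp only [Finset.card_filter]
  have htot : ∑ t ∈ A, (Finset.univ.filter fun d => nbr d t ∈ A).card + (boundary A).card =
      3 * A.card := by
    rw [hbd, ← Finset.sum_add_distrib, Finset.sum_congr rfl fun t _ =>
      Finset.card_filter_add_card_filter_not (s := (Finset.univ : Finset (Fin 3)))
        (fun d => nbr d t ∈ A)]
    simp [mul_comm]
  rw [Nat.card_eq_fintype_card, Nat.card_eq_fintype_card, ← SimpleGraph.edgeFinset_card] at hE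
  have hcard : Fintype.card (A : Set Tile) = A.card := Fintype.card_coe A
  omega

end Tile

/-! ### Filling enclosed regions -/

namespace Tile

/-- A boundary edge seen from its other side. -/
def flip (p : Tile × Fin 3) : Tile × Fin 3 := (nbr p.2 p.1, p.2)

theorem flip_flip (p : Tile × Fin 3) : flip (flip p) = p := by
  simp [flip]

theorem flip_injective : Function.Injective flip :=
  Function.LeftInverse.injective flip_flip

/-- Filling in disjoint regions `T C` that are enclosed by `A` removes at least three boundary edges
per region; the isoperimetric inequality applies to what is left. -/
theorem exists_isoperimetric_of_enclosed {ι : Type*} (A : Finset Tile) (F : Finset ι)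
    (T : ι → Finset Tile) (hne : ∀ C ∈ F, (T C).Nonempty) (hA : ∀ C ∈ F, Disjoint A (T C))
    (hT : Set.PairwiseDisjoint (F : Set ι) T)
    (hcl : ∀ C ∈ F, ∀ t ∈ T C, ∀ d, nbr d t ∉ A → nbr d t ∈ T C) :
    ∃ p : ℕ, 3 * F.card + p ≤ (boundary A).card ∧ 6 * (A.card + F.card) ≤ p ^ 2 + 3 := by
  classical
  set B := A ∪ F.biUnion T with hB
  have hBcard : A.card + F.card ≤ B.card := by
    rw [hB, Finset.card_union_of_disjoint ((Finset.disjoint_biUnion_right _ _ _).2 hA),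
      Finset.card_biUnion hT, Finset.card_eq_sum_ones F]
    exact Nat.add_le_add_left (Finset.sum_le_sum fun C hC => Finset.card_pos.2 (hne C hC)) _
  have hflip : ∀ C ∈ F, ∀ p ∈ boundary (T C), (flip p).1 ∈ A ∧ nbr (flip p).2 (flip p).1 ∈ T C := by
    intro C hC p hp
    rw [mem_boundary] at hp
    refine ⟨?_, by simpa [flip] using hp.1⟩
    by_contra h
    exact hp.2 (hcl C hC _ hp.1 _ h)
  -- The outer boundary of the filled set and the boundaries of the regions, seen from `A`, are
  -- disjoint parts of the boundary of `A`.
  have hsub : boundary B ∪ F.biUnion (fun C => (boundary (T C)).image flip) ⊆ boundary A := by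
    intro p hp
    rw [mem_boundary]
    rcases Finset.mem_union.1 hp with hp | hp
    · obtain ⟨h1, h2⟩ := mem_boundary.1 hp
      rw [hB, Finset.mem_union, not_or] at h2
      refine ⟨?_, h2.1⟩
      rcases Finset.mem_union.1 h1 with h1 | h1
      · exact h1
      · obtain ⟨C, hC, hp1⟩ := Finset.mem_biUnion.1 h1
        exact absurd (Finset.mem_biUnion.2 ⟨C, hC, hcl C hC _ hp1 _ h2.1⟩) h2.2
    · obtain ⟨C, hC, hp⟩ := Finset.mem_biUnion.1 hp
      obtain ⟨q, hq, rfl⟩ := Finset.mem_image.1 hp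
      obtain ⟨h1, h2⟩ := hflip C hC q hq
      exact ⟨h1, Finset.disjoint_right.1 (hA C hC) h2⟩
  have hdisj : Disjoint (boundary B) (F.biUnion fun C => (boundary (T C)).image flip) := by
    rw [Finset.disjoint_left]
    intro p hp hp'
    obtain ⟨C, hC, hp'⟩ := Finset.mem_biUnion.1 hp'
    obtain ⟨q, hq, rfl⟩ := Finset.mem_image.1 hp'
    exact (mem_boundary.1 hp).2
      (Finset.mem_union_right _ (Finset.mem_biUnion.2 ⟨C, hC, (hflip C hC q hq).2⟩))
  have hpair : Set.PairwiseDisjoint (F : Set ι) fun C => (boundary (T C)).image flip := by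
    intro C hC D hD hCD
    rw [Function.onFun, Finset.disjoint_left]
    intro p hp hp'
    obtain ⟨q, hq, rfl⟩ := Finset.mem_image.1 hp
    obtain ⟨q', hq', h⟩ := Finset.mem_image.1 hp'
    obtain rfl := flip_injective h
    exact Finset.disjoint_left.1 (hT hC hD hCD) (mem_boundary.1 hq).1 (mem_boundary.1 hq').1
  refine ⟨(boundary B).card, ?_, le_trans (by omega) (six_mul_card_le B)⟩
  refine le_trans ?_ (Finset.card_le_card hsub)
  rw [Finset.card_union_of_disjoint hdisj, Finset.card_biUnion hpair, add_comm]
  refine Nat.add_le_add_left ?_ _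
  rw [mul_comm, ← smul_eq_mul]
  refine Finset.card_nsmul_le_sum _ _ _ fun C hC => ?_
  rw [Finset.card_image_of_injective _ flip_injective]
  exact three_le_card_boundary (hne C hC)

end Tile

/-! ### Tiles as triangles in the plane -/

/-- The point of the plane with given coordinates with respect to the basis of the lattice. -/
noncomputable def planePoint (a b : ℝ) : Plane := !₂[a + b / 2, b * (Real.sqrt 3 / 2)]

/-- The three strip coordinates of a point of the plane. They add up to one. -/
noncomputable def planeCoord (d : Fin 3) (P : Plane) : ℝ :=
  match d with
  | 0 => P 0 - P 1 / Real.sqrt 3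
  | 1 => 2 * P 1 / Real.sqrt 3
  | 2 => 1 - P 0 - P 1 / Real.sqrt 3

theorem planeCoord_sum (P : Plane) : planeCoord 0 P + planeCoord 1 P + planeCoord 2 P = 1 := by
  simp only [planeCoord]
  ring

theorem planeCoord_planePoint (a b : ℝ) : planeCoord 0 (planePoint a b) = a ∧
    planeCoord 1 (planePoint a b) = b ∧ planeCoord 2 (planePoint a b) = 1 - a - b := by
  have h : Real.sqrt 3 ≠ 0 := by positivity
  simp only [planeCoord, planePoint]
  refine ⟨?_, ?_, ?_⟩ <;> simp <;> field_simp <;> ring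

theorem planePoint_planeCoord (P : Plane) : planePoint (planeCoord 0 P) (planeCoord 1 P) = P := by
  have h : Real.sqrt 3 ≠ 0 := by positivity
  ext i
  fin_cases i <;> simp [planeCoord, planePoint] <;> field_simp <;> ring

theorem eq_of_planeCoord_eq {P Q : Plane} (h : ∀ d, planeCoord d P = planeCoord d Q) : P = Q := by
  rw [← planePoint_planeCoord P, ← planePoint_planeCoord Q, h 0, h 1]

theorem continuous_planeCoord (d : Fin 3) : Continuous (planeCoord d) := by
  fin_cases d <;> unfold planeCoord <;> simp only <;> fun_prop

theorem planeCoord_combo (d : Fin 3) (P Q : Plane) {u v : ℝ} (h : u + v = 1) :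
    planeCoord d (u • P + v • Q) = u * planeCoord d P + v * planeCoord d Q := by
  obtain rfl : v = 1 - u := by linarith
  fin_cases d <;> simp [planeCoord] <;> ring

theorem planeCoord_combo_three (d : Fin 3) (P Q R : Plane) {u v w : ℝ} (h : u + v + w = 1) :
    planeCoord d (u • P + v • Q + w • R) =
      u * planeCoord d P + v * planeCoord d Q + w * planeCoord d R := by
  obtain rfl : w = 1 - u - v := by linarith
  fin_cases d <;> simp [planeCoord] <;> ring

/-- The points whose strip coordinates lie in prescribed sets. -/
def coordBox (S : Fin 3 → Set ℝ) : Set Plane := {P | ∀ d, planeCoord d P ∈ S d}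

theorem convex_coordBox {S : Fin 3 → Set ℝ} (hS : ∀ d, Convex ℝ (S d)) :
    Convex ℝ (coordBox S) := by
  intro P hP Q hQ u v hu hv huv d
  rw [planeCoord_combo d P Q huv]
  exact hS d (hP d) (hQ d) hu hv huv

theorem isOpen_coordBox {S : Fin 3 → Set ℝ} (hS : ∀ d, IsOpen (S d)) : IsOpen (coordBox S) := by
  have : coordBox S = ⋂ d, planeCoord d ⁻¹' S d := by
    ext P
    simp [coordBox]
  rw [this]
  exact isOpen_iInter_of_finite fun d => (hS d).preimage (continuous_planeCoord d)

theorem mem_of_combo_three {s : Set Plane} (hs : Convex ℝ s) {P Q R : Plane} (hP : P ∈ s)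
    (hQ : Q ∈ s) (hR : R ∈ s) {u v w : ℝ} (hu : 0 ≤ u) (hv : 0 ≤ v) (hw : 0 ≤ w)
    (h : u + v + w = 1) : u • P + v • Q + w • R ∈ s := by
  have := hs.sum_mem (t := Finset.univ) (w := ![u, v, w]) (z := ![P, Q, R])
    (by intro i _; fin_cases i <;> assumption) (by simpa [Fin.sum_univ_three] using h)
    (by intro i _; fin_cases i <;> assumption)
  simpa [Fin.sum_univ_three] using this

namespace Tile

/-- The interior of the triangle that a tile occupies. -/
def openRegion (t : Tile) : Set Plane :=
  coordBox fun d => Set.Ioo (coord d t : ℝ) (coord d t + 1)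

/-- Turns the geometry of tiles into linear inequalities. The inclusion of the box in the convex
hull is proved with explicit barycentric coordinates. -/
theorem region_eq (t : Tile) :
    t.region = coordBox fun d => Set.Icc (coord d t : ℝ) (coord d t + 1) := by
  have hpt : ∀ v : ℤ × ℤ, latticePoint v = planePoint v.1 v.2 := fun v => rfl
  refine Set.Subset.antisymm (convexHull_min ?_ (convex_coordBox fun d => convex_Icc _ _)) ?_
  · rintro _ ⟨⟨a, b⟩, hv, rfl⟩ d
    obtain ⟨h0, h1, h2⟩ := planeCoord_planePoint a b
    rw [hpt]
    obtain ⟨i, j, u⟩ := t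
    have key : ∀ (x : ℝ) (m n : ℤ), x = n → m ≤ n → n ≤ m + 1 → x ∈ Set.Icc (m : ℝ) (m + 1) := by
      rintro _ m n rfl h h'
      exact ⟨by exact_mod_cast h, by exact_mod_cast h'⟩
    cases u <;> simp [vertices] at hv <;> fin_cases d
    all_goals first
      | exact key _ _ _ h0 (by simp only [coord]; omega) (by simp only [coord]; omega)
      | exact key _ _ _ h1 (by simp only [coord]; omega) (by simp only [coord]; omega)
      | exact key _ _ (1 - a - b) (by push_cast; exact h2) (by simp [coord]; omega)
          (by simp [coord]; omega)
  · intro P hP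
    have hsum := planeCoord_sum P
    have hconv := convex_convexHull ℝ (latticePoint '' (t.vertices : Set (ℤ × ℤ)))
    have hmem : ∀ v ∈ t.vertices, planePoint (v.1 : ℝ) (v.2 : ℝ) ∈
        convexHull ℝ (latticePoint '' (t.vertices : Set (ℤ × ℤ))) := fun v hv =>
      subset_convexHull ℝ _ ⟨v, hv, rfl⟩
    obtain ⟨i, j, u⟩ := t
    obtain ⟨a0, b0⟩ := hP 0
    obtain ⟨a1, b1⟩ := hP 1
    obtain ⟨a2, b2⟩ := hP 2
    unfold region
    cases u
    · have h1 := hmem (i, j + 1) (by simp [vertices])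
      have h2 := hmem (i + 1, j) (by simp [vertices])
      have h3 := hmem (i + 1, j + 1) (by simp [vertices])
      simp [coord] at a0 a1 a2 b0 b1 b2
      have := mem_of_combo_three hconv h1 h2 h3 (u := i + 1 - planeCoord 0 P)
        (v := j + 1 - planeCoord 1 P) (w := planeCoord 0 P + planeCoord 1 P - i - j - 1)
        (by linarith) (by linarith) (by linarith) (by ring)
      convert this using 1
      refine eq_of_planeCoord_eq fun d => ?_
      rw [planeCoord_combo_three _ _ _ _ (by ring)]
      fin_cases d <;> simp [planeCoord_planePoint] <;> linarith
    · have h1 := hmem (i, j) (by simp [vertices])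
      have h2 := hmem (i + 1, j) (by simp [vertices])
      have h3 := hmem (i, j + 1) (by simp [vertices])
      simp [coord] at a0 a1 a2 b0 b1 b2
      have := mem_of_combo_three hconv h1 h2 h3
        (u := 1 - (planeCoord 0 P - i) - (planeCoord 1 P - j))
        (v := planeCoord 0 P - i) (w := planeCoord 1 P - j)
        (by linarith) (by linarith) (by linarith) (by ring)
      convert this using 1
      refine eq_of_planeCoord_eq fun d => ?_
      rw [planeCoord_combo_three _ _ _ _ (by ring)]
      fin_cases d <;> simp [planeCoord_planePoint] <;> linarith

theorem openRegion_subset_region (t : Tile) : t.openRegion ⊆ t.region := by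
  rw [region_eq]
  exact fun P hP d => Set.Ioo_subset_Icc_self (hP d)

theorem isClosed_region (t : Tile) : IsClosed t.region := by
  have : t.region = ⋂ d, planeCoord d ⁻¹' Set.Icc (coord d t : ℝ) (coord d t + 1) := by
    rw [region_eq]
    ext P
    simp [coordBox]
  rw [this]
  exact isClosed_iInter fun d => isClosed_Icc.preimage (continuous_planeCoord d)

theorem isBounded_region (t : Tile) : Bornology.IsBounded t.region :=
  isBounded_convexHull.2 ((t.vertices.finite_toSet.image latticePoint).isBounded)

/-- The centre of the triangle that a tile occupies. -/
noncomputable def center (t : Tile) : Plane :=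
  planePoint (t.i + if t.up then 1 / 3 else 2 / 3) (t.j + if t.up then 1 / 3 else 2 / 3)

theorem center_mem_openRegion (t : Tile) : t.center ∈ t.openRegion := by
  obtain ⟨i, j, u⟩ := t
  have key : ∀ c : ℝ, ∀ d, planeCoord d (planePoint (i + c) (j + c)) =
      ![i + c, j + c, 1 - (i + c) - (j + c)] d := by
    intro c d
    obtain ⟨h0, h1, h2⟩ := planeCoord_planePoint (i + c) (j + c)
    fin_cases d
    exacts [h0, h1, h2]
  intro d
  rw [Set.mem_Ioo, center, key]
  cases u <;> fin_cases d <;> simp [coord] <;> norm_num <;> constructor <;> linarith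

theorem exists_mem_region (P : Plane) : ∃ t : Tile, P ∈ t.region := by
  have hs := planeCoord_sum P
  have h0 := Int.floor_le (planeCoord 0 P)
  have h0' := Int.lt_floor_add_one (planeCoord 0 P)
  have h1 := Int.floor_le (planeCoord 1 P)
  have h1' := Int.lt_floor_add_one (planeCoord 1 P)
  by_cases h : planeCoord 0 P + planeCoord 1 P ≤ ⌊planeCoord 0 P⌋ + ⌊planeCoord 1 P⌋ + 1
  · refine ⟨⟨⌊planeCoord 0 P⌋, ⌊planeCoord 1 P⌋, true⟩, ?_⟩
    rw [region_eq]
    intro d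
    fin_cases d <;> simp [coord] <;> (try constructor) <;> linarith
  · refine ⟨⟨⌊planeCoord 0 P⌋, ⌊planeCoord 1 P⌋, false⟩, ?_⟩
    rw [region_eq]
    intro d
    fin_cases d <;> simp [coord] <;> (try constructor) <;> linarith

/-- An open unit interval with integer ends meets a closed one only if they have the same ends. -/
theorem coord_eq_of_mem {t s : Tile} {P : Plane} {d : Fin 3}
    (ht : planeCoord d P ∈ Set.Ioo (coord d t : ℝ) (coord d t + 1)) (hs : P ∈ s.region) :
    coord d s = coord d t := by
  rw [region_eq] at hs
  have h := hs d
  have h1 : (coord d s : ℝ) < coord d t + 1 := lt_of_le_of_lt h.1 ht.2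
  have h2 : (coord d t : ℝ) < coord d s + 1 := lt_of_lt_of_le ht.1 h.2
  norm_cast at h1 h2
  omega

theorem eq_of_mem_openRegion_of_mem_region {t s : Tile} {P : Plane} (ht : P ∈ t.openRegion)
    (hs : P ∈ s.region) : s = t :=
  eq_of_coord_eq fun d => coord_eq_of_mem (ht d) hs

theorem openRegion_subset_compl_shape {A : Finset Tile} {t : Tile} (ht : t ∉ A) :
    t.openRegion ⊆ (shape A)ᶜ := by
  intro P hP hA
  obtain ⟨s, hs, hPs⟩ := Set.mem_iUnion₂.1 hA
  exact ht (eq_of_mem_openRegion_of_mem_region hP hPs ▸ hs)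

theorem center_mem_compl_shape_iff {A : Finset Tile} {t : Tile} :
    t.center ∈ (shape A)ᶜ ↔ t ∉ A := by
  refine ⟨fun h ht => h ?_, fun h => openRegion_subset_compl_shape h t.center_mem_openRegion⟩
  exact Set.mem_biUnion (Finset.mem_coe.2 ht) (t.openRegion_subset_region t.center_mem_openRegion)

/-- The open rhombus formed by two adjacent tiles. -/
def openRhombus (d : Fin 3) (t : Tile) : Set Plane :=
  coordBox fun e => Set.Ioo (if e = d then coord e t - 1 else coord e t : ℝ) (coord e t + 1)

theorem eq_or_eq_of_mem_openRhombus {d : Fin 3} {t s : Tile} (hu : t.up = true) {P : Plane}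
    (hP : P ∈ openRhombus d t) (hs : P ∈ s.region) : s = t ∨ s = nbr d t := by
  have hne : ∀ e, e ≠ d → coord e s = coord e t := by
    intro e he
    have := hP e
    simp only [if_neg he] at this
    exact coord_eq_of_mem this hs
  have hd := hP d
  simp only [if_true] at hd
  rw [region_eq] at hs
  have h1 : (coord d s : ℝ) < coord d t + 1 := lt_of_le_of_lt (hs d).1 hd.2
  have h2 : (coord d t : ℝ) - 1 < coord d s + 1 := lt_of_lt_of_le hd.1 (hs d).2
  norm_cast at h1 h2
  have hn := coord_nbr_self d t
  rw [hu, if_pos rfl] at hn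
  rcases (show coord d s = coord d t ∨ coord d s = coord d t - 1 by omega) with h | h
  · refine Or.inl (eq_of_coord_eq fun e => ?_)
    by_cases he : e = d
    · rw [he, h]
    · exact hne e he
  · refine Or.inr (eq_of_coord_eq fun e => ?_)
    by_cases he : e = d
    · rw [he, h, hn]
    · rw [hne e he, coord_nbr_of_ne he]

/-- The open rhombus is convex and meets no closed tile but the two that form it. Hence a hole
containing one missing tile contains all missing neighbours. -/
theorem exists_preconnected_of_adjacent {A : Finset Tile} {t : Tile} {d : Fin 3} (ht : t ∉ A)
    (hn : nbr d t ∉ A) : ∃ K : Set Plane, IsPreconnected K ∧ K ⊆ (shape A)ᶜ ∧ t.center ∈ K ∧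
      (nbr d t).center ∈ K := by
  wlog hu : t.up = true generalizing t
  · obtain ⟨K, h1, h2, h3, h4⟩ := this hn (by rwa [nbr_nbr]) (by rw [up_nbr]; simpa using hu)
    rw [nbr_nbr] at h4
    exact ⟨K, h1, h2, h4, h3⟩
  refine ⟨openRhombus d t, (convex_coordBox fun e => convex_Ioo _ _).isPreconnected, ?_, ?_, ?_⟩
  · intro P hP hA
    obtain ⟨s, hs, hPs⟩ := Set.mem_iUnion₂.1 hA
    rcases eq_or_eq_of_mem_openRhombus hu hP hPs with rfl | rfl
    exacts [ht hs, hn hs]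
  · intro e
    obtain ⟨h1, h2⟩ := t.center_mem_openRegion e
    refine ⟨?_, h2⟩
    split_ifs <;> linarith
  · intro e
    obtain ⟨h1, h2⟩ := (nbr d t).center_mem_openRegion e
    by_cases he : e = d
    · subst he
      rw [coord_nbr_self, hu, if_pos rfl] at h1 h2
      push_cast at h1 h2
      simp only [if_true]
      exact ⟨h1, by linarith⟩
    · rw [coord_nbr_of_ne he] at h1 h2
      simp only [if_neg he]
      exact ⟨h1, h2⟩

/-- The segment to the centre enters the open triangle at once, even when `P` lies on its border.
Hence every hole contains the centre of a tile. -/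
theorem exists_preconnected_of_mem_region {A : Finset Tile} {t : Tile} {P : Plane} (ht : t ∉ A)
    (hP : P ∈ (shape A)ᶜ) (hPt : P ∈ t.region) :
    ∃ K : Set Plane, IsPreconnected K ∧ K ⊆ (shape A)ᶜ ∧ P ∈ K ∧ t.center ∈ K := by
  refine ⟨segment ℝ P t.center, (convex_segment _ _).isPreconnected, ?_, left_mem_segment _ _ _,
    right_mem_segment _ _ _⟩
  rintro _ ⟨u, v, hu, hv, huv, rfl⟩
  rcases hv.eq_or_lt with rfl | hv
  · obtain rfl : u = 1 := by linarith
    simpa using hP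
  · refine openRegion_subset_compl_shape ht fun d => ?_
    rw [region_eq] at hPt
    obtain ⟨h1, h2⟩ := hPt d
    obtain ⟨h3, h4⟩ := t.center_mem_openRegion d
    rw [planeCoord_combo d _ _ huv]
    obtain rfl : u = 1 - v := by linarith
    constructor <;> nlinarith

end Tile

/-! ### Holes and sets of missing tiles -/

open Tile

theorem exists_mem_of_isPreconnected {A : Finset Tile} {C K : Set Plane} (hC : C ∈ holes A)
    (hK : IsPreconnected K) (hKA : K ⊆ (shape A)ᶜ) {P : Plane} (hPK : P ∈ K) (hPC : P ∈ C) :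
    K ⊆ C := by
  obtain ⟨⟨x, -, rfl⟩, -⟩ := hC
  rw [connectedComponentIn_eq hPC]
  exact hK.subset_connectedComponentIn hPK hKA

theorem holes_subset_compl_shape {A : Finset Tile} {C : Set Plane} (hC : C ∈ holes A) :
    C ⊆ (shape A)ᶜ := by
  obtain ⟨⟨x, -, rfl⟩, -⟩ := hC
  exact connectedComponentIn_subset _ _

theorem exists_center_mem_hole {A : Finset Tile} {C : Set Plane} (hC : C ∈ holes A) :
    ∃ t : Tile, t.center ∈ C := by
  obtain ⟨P, hP⟩ : C.Nonempty := by
    obtain ⟨⟨x, hx, rfl⟩, -⟩ := hC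
    exact ⟨x, mem_connectedComponentIn hx⟩
  have hPA := holes_subset_compl_shape hC hP
  obtain ⟨t, ht⟩ := exists_mem_region P
  have htA : t ∉ A := fun h => hPA (Set.mem_biUnion (Finset.mem_coe.2 h) ht)
  obtain ⟨K, h1, h2, h3, h4⟩ := exists_preconnected_of_mem_region htA hPA ht
  exact ⟨t, exists_mem_of_isPreconnected hC h1 h2 h3 hP h4⟩

theorem eq_of_mem_holes {A : Finset Tile} {C D : Set Plane} (hC : C ∈ holes A) (hD : D ∈ holes A)
    {P : Plane} (hPC : P ∈ C) (hPD : P ∈ D) : C = D := by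
  obtain ⟨⟨x, -, rfl⟩, -⟩ := hC
  obtain ⟨⟨y, -, rfl⟩, -⟩ := hD
  rw [connectedComponentIn_eq hPC, connectedComponentIn_eq hPD]

theorem finite_centers_mem {C : Set Plane} (hC : Bornology.IsBounded C) :
    {t : Tile | t.center ∈ C}.Finite := by
  have hbd : ∀ d, ∃ M : ℤ, ∀ P ∈ C, |planeCoord d P| ≤ M := by
    intro d
    obtain ⟨M, hM⟩ := (hC.isCompact_closure.image (continuous_planeCoord d)).isBounded.exists_norm_le
    obtain ⟨N, hN⟩ := exists_nat_ge M
    exact ⟨N, fun P hP => (hM _ ⟨P, subset_closure hP, rfl⟩).trans (by exact_mod_cast hN)⟩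
  obtain ⟨M, hM⟩ := hbd 0
  obtain ⟨N, hN⟩ := hbd 1
  refine Set.Finite.subset (((Finset.Icc (-M - 1) M) ×ˢ (Finset.Icc (-N - 1) N) ×ˢ
    (Finset.univ : Finset Bool)).image fun p => (⟨p.1, p.2.1, p.2.2⟩ : Tile)).finite_toSet ?_
  intro t ht
  have h0 := abs_le.1 (hM _ ht)
  have h1 := abs_le.1 (hN _ ht)
  have c0 := t.center_mem_openRegion 0
  have c1 := t.center_mem_openRegion 1
  simp only [coord, Set.mem_Ioo] at c0 c1
  have e1 : (t.i : ℝ) < M := by linarith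
  have e2 : (-M : ℝ) < t.i + 1 := by linarith
  have e3 : (t.j : ℝ) < N := by linarith
  have e4 : (-N : ℝ) < t.j + 1 := by linarith
  norm_cast at e1 e2 e3 e4
  rw [Finset.coe_image]
  refine ⟨(t.i, t.j, t.up), ?_, rfl⟩
  simp only [Finset.coe_product, Set.mem_prod, Finset.coe_Icc, Set.mem_Icc, Finset.coe_univ,
    Set.mem_univ, and_true]
  omega

/-- The fundamental inequality between the numbers of tiles and of holes of a polyiamond. -/
theorem exists_inequality_of_subset_holes {A : Finset Tile} (hA : IsPolyiamond A)
    (F : Finset (Set Plane)) (hF : (F : Set (Set Plane)) ⊆ holes A) :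
    ∃ p : ℕ, 3 * F.card + p ≤ A.card + 2 ∧ 6 * (A.card + F.card) ≤ p ^ 2 + 3 := by
  -- A hole is represented by the tiles whose centres it contains. The empty set outside `F` is a
  -- dummy value.
  have hex : ∀ C : Set Plane, ∃ T : Finset Tile, C ∈ F → ∀ t, t ∈ T ↔ t.center ∈ C := by
    intro C
    by_cases hC : C ∈ F
    · exact ⟨(finite_centers_mem (hF hC).2).toFinset, fun _ t => by simp⟩
    · exact ⟨∅, fun h => absurd h hC⟩
  choose T hT using hex
  refine (exists_isoperimetric_of_enclosed A F T ?_ ?_ ?_ ?_).imp fun p h =>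
    ⟨h.1.trans (card_boundary_le hA), h.2⟩
  · intro C hC
    obtain ⟨t, ht⟩ := exists_center_mem_hole (hF hC)
    exact ⟨t, (hT C hC t).2 ht⟩
  · intro C hC
    rw [Finset.disjoint_right]
    intro t ht
    exact center_mem_compl_shape_iff.1 (holes_subset_compl_shape (hF hC) ((hT C hC t).1 ht))
  · intro C hC D hD hCD
    rw [Function.onFun, Finset.disjoint_left]
    intro t ht ht'
    exact hCD (eq_of_mem_holes (hF hC) (hF hD) ((hT C hC t).1 ht) ((hT D hD t).1 ht'))
  · intro C hC t ht d hd
    rw [hT C hC] at ht ⊢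
    have htA := center_mem_compl_shape_iff.1 (holes_subset_compl_shape (hF hC) ht)
    obtain ⟨K, k1, k2, k3, k4⟩ := exists_preconnected_of_adjacent htA hd
    exact exists_mem_of_isPreconnected (hF hC) k1 k2 k3 ht k4

/-- The open triangle and the complement of the closed one are disjoint open sets. Together they
cover the complement of the shape, since the border of `t` is covered by its neighbours; so a
connected set cannot leave the triangle. -/
theorem connectedComponentIn_center_subset {A : Finset Tile} {t : Tile} (ht : t ∉ A)
    (hn : ∀ d, nbr d t ∈ A) :
    connectedComponentIn (shape A)ᶜ t.center ⊆ t.openRegion := by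
  refine isPreconnected_connectedComponentIn.subset_left_of_subset_union
    (isOpen_coordBox fun d => isOpen_Ioo) t.isClosed_region.isOpen_compl
    (Set.disjoint_compl_right_iff_subset.2 t.openRegion_subset_region) ?_
    ⟨t.center, mem_connectedComponentIn (center_mem_compl_shape_iff.2 ht), t.center_mem_openRegion⟩
  intro P hP
  by_contra hcon
  rw [Set.mem_union, not_or, Set.mem_compl_iff, not_not] at hcon
  obtain ⟨h1, h2⟩ := hcon
  suffices ∃ d, P ∈ (nbr d t).region by
    obtain ⟨d, hd⟩ := this
    exact connectedComponentIn_subset _ _ hP (Set.mem_biUnion (Finset.mem_coe.2 (hn d)) hd)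
  by_contra hno
  push Not at hno
  rw [region_eq] at h2
  have hs := planeCoord_sum P
  have hc : (coord 0 t + coord 1 t + coord 2 t : ℝ) = if t.up then 0 else -1 := by
    have := coord_sum t
    split_ifs at this ⊢ <;> exact_mod_cast this
  have hcross : ∀ d, planeCoord d P ∈
      Set.Icc (coord d (nbr d t) : ℝ) (coord d (nbr d t) + 1) → False := by
    intro d hd
    refine hno d ?_
    rw [region_eq]
    intro e
    by_cases he : e = d
    · rw [he]
      exact hd
    · simp only [coord_nbr_of_ne he]
      exact h2 e
  -- A triangle is cut out by one inequality per direction, an upper bound for down-triangles and a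
  -- lower bound for up-triangles. The opposite bounds follow from the sum of the coordinates.
  cases hu : t.up
  · have hlt : ∀ d, planeCoord d P < coord d t + 1 := by
      refine fun d => lt_of_le_of_ne (h2 d).2 fun h => hcross d ?_
      rw [coord_nbr_self, hu, h]
      constructor <;> push_cast <;> simp
    have l0 := hlt 0
    have l1 := hlt 1
    have l2 := hlt 2
    rw [hu] at hc
    simp at hc
    refine h1 fun d => ⟨?_, hlt d⟩
    fin_cases d <;> simp <;> linarith
  · have hlt : ∀ d, coord d t < planeCoord d P := by
      refine fun d => lt_of_le_of_ne (h2 d).1 fun h => hcross d ?_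
      rw [coord_nbr_self, hu, ← h]
      constructor <;> push_cast <;> simp
    have l0 := hlt 0
    have l1 := hlt 1
    have l2 := hlt 2
    rw [hu] at hc
    simp at hc
    refine h1 fun d => ⟨hlt d, ?_⟩
    fin_cases d <;> simp <;> linarith

theorem exists_finset_subset_holes {A S : Finset Tile} (hS : ∀ t ∈ S, t ∉ A ∧ ∀ d, nbr d t ∈ A) :
    ∃ F : Finset (Set Plane), (F : Set (Set Plane)) ⊆ holes A ∧ F.card = S.card := by
  classical
  refine ⟨S.image fun t => connectedComponentIn (shape A)ᶜ t.center, ?_, ?_⟩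
  · intro C hC
    rw [Finset.coe_image] at hC
    obtain ⟨t, ht, rfl⟩ := hC
    obtain ⟨h1, h2⟩ := hS t ht
    exact ⟨⟨t.center, center_mem_compl_shape_iff.2 h1, rfl⟩, t.isBounded_region.subset
      ((connectedComponentIn_center_subset h1 h2).trans t.openRegion_subset_region)⟩
  · refine Finset.card_image_of_injOn fun s hs t ht hst => ?_
    obtain ⟨h1, -⟩ := hS s hs
    obtain ⟨h3, h4⟩ := hS t ht
    have hmem := mem_connectedComponentIn (center_mem_compl_shape_iff.2 h1)
    rw [show connectedComponentIn _ _ = _ from hst] at hmem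
    exact eq_of_mem_openRegion_of_mem_region (connectedComponentIn_center_subset h3 h4 hmem)
      (s.openRegion_subset_region s.center_mem_openRegion)

/-! ### Nested hexagons and the holes in their rings -/

namespace Tile

/-- The tiles of a hexagon of perimeter `6 * m` whose sides have lengths
`m + 1, m - 1, m, m + 1, m - 1, m`. -/
def InHexagon (m : ℤ) (t : Tile) : Prop :=
  -m ≤ t.i ∧ t.i ≤ m - 1 ∧ -(m - 1) ≤ t.j ∧ t.j ≤ m - 1 ∧ -m ≤ coord 2 t ∧ coord 2 t ≤ m

/-- The tiles to be removed from the ring around the `m`-th hexagon: every other tile of those that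
share an edge with the hexagon. -/
def IsRingHole (m : ℤ) (t : Tile) : Prop :=
  ¬ InHexagon m t ∧
    ((InHexagon m (nbr 0 t) ∧ (if t.up then coord 2 t else coord 1 t) % 2 = 1) ∨
      (InHexagon m (nbr 1 t) ∧ (if t.up then coord 0 t else coord 2 t) % 2 = 1) ∨
      (InHexagon m (nbr 2 t) ∧ (if t.up then coord 1 t else coord 0 t) % 2 = 1))

theorem InHexagon.mono {m n : ℤ} {t : Tile} (h : InHexagon m t) (hmn : m ≤ n) : InHexagon n t := by
  unfold InHexagon at h ⊢
  omega

theorem InHexagon.of_nbr {m : ℤ} {t : Tile} {d : Fin 3} (h : InHexagon m (nbr d t)) :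
    InHexagon (m + 1) t := by
  obtain ⟨i, j, u⟩ := t
  fin_cases d <;> cases u <;> simp [InHexagon, nbr, coord] at h ⊢ <;> omega

theorem IsRingHole.inHexagon {m : ℤ} {t : Tile} (h : IsRingHole m t) : InHexagon (m + 1) t := by
  rcases h.2 with h | h | h <;> exact h.1.of_nbr

theorem IsRingHole.eq {m n : ℤ} {t : Tile} (h : InHexagon (m + 1) t) (h' : ¬ InHexagon m t)
    (hn : IsRingHole n t) : n = m := by
  rcases lt_trichotomy n m with hlt | heq | hlt
  · exact absurd (hn.inHexagon.mono (by omega)) h'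
  · exact heq
  · exact absurd (h.mono (by omega)) hn.1

theorem IsRingHole.inHexagon_nbr {m : ℤ} {t : Tile} (h : IsRingHole m t) (d : Fin 3) :
    InHexagon (m + 1) (nbr d t) := by
  obtain ⟨i, j, u⟩ := t
  fin_cases d <;> cases u <;> simp [IsRingHole, InHexagon, nbr, coord] at h ⊢ <;> omega

/-- With `IsRingHole.inHexagon_nbr` this makes each removed tile a hole of its own: its neighbours
lie in the next hexagon and are never removed. -/
theorem IsRingHole.not_isRingHole_nbr {m : ℤ} {t : Tile} (h : IsRingHole m t) (n : ℤ)
    (d : Fin 3) : ¬ IsRingHole n (nbr d t) := by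
  intro h'
  have hn : n = m ∨ n = m - 1 := by
    have h1 := h.inHexagon_nbr d
    by_cases h2 : InHexagon m (nbr d t)
    · refine Or.inr ?_
      by_contra hne
      have h3 := h'.inHexagon_nbr d
      rw [nbr_nbr] at h3
      rcases lt_or_ge n m with hlt | hge
      · exact h.1 (h3.mono (by omega))
      · exact h'.1 (h2.mono hge)
    · exact Or.inl (IsRingHole.eq h1 h2 h')
  obtain ⟨i, j, u⟩ := t
  rcases hn with rfl | rfl <;> fin_cases d <;> cases u <;>
    simp [IsRingHole, InHexagon, nbr, coord] at h h' <;> omega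

/-- Inside the hexagon, the tiles along its border all survive, so a ring tile adjacent to the
hexagon is attached to a remaining tile. -/
theorem not_isRingHole_nbr_of_inHexagon {m : ℤ} {t : Tile} {d : Fin 3} (ht : ¬ InHexagon m t)
    (hd : InHexagon m (nbr d t)) (n : ℤ) : ¬ IsRingHole n (nbr d t) := by
  intro h
  have h1 := h.inHexagon_nbr d
  rw [nbr_nbr] at h1
  rcases lt_or_ge n m with hlt | hge
  · exact ht (h1.mono (by omega))
  · exact h.1 (hd.mono hge)

/-- A tile that remains in the ring around the `m`-th hexagon. -/
def IsRingTile (m : ℤ) (t : Tile) : Prop :=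
  InHexagon (m + 1) t ∧ ¬ InHexagon m t ∧ ¬ IsRingHole m t

set_option maxHeartbeats 2000000 in
/-- Every remaining tile of a ring is joined, within the ring, to one that is adjacent to the
hexagon inside the ring. -/
theorem IsRingTile.induction {m : ℤ} (hm : 1 ≤ m) {Q : Tile → Prop}
    (h0 : ∀ t, IsRingTile m t → ∀ d, InHexagon m (nbr d t) → Q t)
    (h1 : ∀ t, IsRingTile m t → ∀ d, Q (nbr d t) → Q t) (t : Tile) (ht : IsRingTile m t) :
    Q t := by
  have two : ∀ t, IsRingTile m t → ∀ d e, IsRingTile m (nbr d t) → InHexagon m (nbr e (nbr d t)) →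
      Q t := fun t ht d e hd he => h1 t ht d (h0 _ hd e he)
  have three : ∀ t, IsRingTile m t → ∀ d e f, IsRingTile m (nbr d t) →
      IsRingTile m (nbr e (nbr d t)) → InHexagon m (nbr f (nbr e (nbr d t))) → Q t :=
    fun t ht d e f hd he hf => h1 t ht d (two _ hd e f he hf)
  have four : ∀ t, IsRingTile m t → ∀ d e f g, IsRingTile m (nbr d t) →
      IsRingTile m (nbr e (nbr d t)) → IsRingTile m (nbr f (nbr e (nbr d t))) →
      InHexagon m (nbr g (nbr f (nbr e (nbr d t)))) → Q t :=
    fun t ht d e f g hd he hf hg => h1 t ht d (three _ hd e f g he hf hg)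
  by_cases hin : ∃ d, InHexagon m (nbr d t)
  · obtain ⟨d, hd⟩ := hin
    exact h0 t ht d hd
  have hin0 : ¬ InHexagon m (nbr 0 t) := fun h => hin ⟨0, h⟩
  have hin1 : ¬ InHexagon m (nbr 1 t) := fun h => hin ⟨1, h⟩
  have hin2 : ¬ InHexagon m (nbr 2 t) := fun h => hin ⟨2, h⟩
  have ht' := ht
  obtain ⟨ha, hb, -⟩ := ht'
  clear hin h0 h1
  obtain ⟨i, j, u⟩ := t
  cases u
  · simp [InHexagon, nbr, coord] at ha hb hin0 hin1 hin2
    -- A tile without a neighbour in the inner hexagon lies in an extremal strip of the outer one.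
    -- Parity decides along which side of the strip the path can avoid the removed tiles; near a
    -- corner it has to be longer, most of all for `m = 1`.
    rcases (show i = m ∨ j = m ∨ -(i + j) - 1 = m + 1 by omega) with h | h | h
    · rcases (show ((-(i + j) - 1) % 2 = 0 ∧ j ≤ -1) ∨
          ((-(i + j) - 1) % 2 = 1 ∧ -(m - 1) ≤ j) ∨
          ((-(i + j) - 1) % 2 = 1 ∧ j = -m) ∨
          ((-(i + j) - 1) % 2 = 0 ∧ j = 0 ∧ 2 ≤ m) ∨
          (j = 0 ∧ m = 1) by omega) with h' | h' | h' | h' | h'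
      · refine two _ ht 1 0 ?_ ?_ <;>
          simp [IsRingTile, IsRingHole, InHexagon, nbr, coord] <;> omega
      · refine two _ ht 2 0 ?_ ?_ <;>
          simp [IsRingTile, IsRingHole, InHexagon, nbr, coord] <;> omega
      · refine three _ ht 2 0 1 ?_ ?_ ?_ <;>
          simp [IsRingTile, IsRingHole, InHexagon, nbr, coord] <;> omega
      · refine three _ ht 1 0 2 ?_ ?_ ?_ <;>
          simp [IsRingTile, IsRingHole, InHexagon, nbr, coord] <;> omega
      · refine four _ ht 1 0 2 1 ?_ ?_ ?_ ?_ <;>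
          simp [IsRingTile, IsRingHole, InHexagon, nbr, coord] <;> omega
    · rcases (show (i % 2 = 0 ∧ -m ≤ i) ∨
          i % 2 = 1 ∨
          (i % 2 = 0 ∧ i = -m - 1) by omega) with h' | h' | h'
      · refine two _ ht 2 1 ?_ ?_ <;>
          simp [IsRingTile, IsRingHole, InHexagon, nbr, coord] <;> omega
      · refine two _ ht 0 1 ?_ ?_ <;>
          simp [IsRingTile, IsRingHole, InHexagon, nbr, coord] <;> omega
      · refine three _ ht 2 1 0 ?_ ?_ ?_ <;>
          simp [IsRingTile, IsRingHole, InHexagon, nbr, coord] <;> omega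
    · rcases (show (j % 2 = 0 ∧ -(m - 1) ≤ j) ∨
          (j % 2 = 1 ∧ j ≤ -2) ∨
          (j % 2 = 0 ∧ j = -m) ∨
          j = -1 by omega) with h' | h' | h' | h'
      · refine two _ ht 0 2 ?_ ?_ <;>
          simp [IsRingTile, IsRingHole, InHexagon, nbr, coord] <;> omega
      · refine two _ ht 1 2 ?_ ?_ <;>
          simp [IsRingTile, IsRingHole, InHexagon, nbr, coord] <;> omega
      · refine three _ ht 0 2 1 ?_ ?_ ?_ <;>
          simp [IsRingTile, IsRingHole, InHexagon, nbr, coord] <;> omega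
      · refine three _ ht 1 2 0 ?_ ?_ ?_ <;>
          simp [IsRingTile, IsRingHole, InHexagon, nbr, coord] <;> omega
  · simp [InHexagon, nbr, coord] at ha hb hin0 hin1 hin2
    rcases (show i = -m - 1 ∨ j = -m ∨ i + j = m + 1 by omega) with h | h | h
    · rcases (show (j % 2 = 0 ∧ j ≤ m - 1) ∨
          j % 2 = 1 ∨
          (j % 2 = 0 ∧ j = m) by omega) with h' | h' | h'
      · refine two _ ht 2 0 ?_ ?_ <;>
          simp [IsRingTile, IsRingHole, InHexagon, nbr, coord] <;> omega
      · refine two _ ht 1 0 ?_ ?_ <;>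
          simp [IsRingTile, IsRingHole, InHexagon, nbr, coord] <;> omega
      · refine three _ ht 2 0 1 ?_ ?_ ?_ <;>
          simp [IsRingTile, IsRingHole, InHexagon, nbr, coord] <;> omega
    · rcases (show ((i + j) % 2 = 0 ∧ 0 ≤ i) ∨
          ((i + j) % 2 = 1 ∧ i ≤ m - 1) ∨
          ((i + j) % 2 = 0 ∧ i = -1 ∧ 2 ≤ m) ∨
          (i = -1 ∧ m = 1) by omega) with h' | h' | h' | h'
      · refine two _ ht 0 1 ?_ ?_ <;>
          simp [IsRingTile, IsRingHole, InHexagon, nbr, coord] <;> omega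
      · refine two _ ht 2 1 ?_ ?_ <;>
          simp [IsRingTile, IsRingHole, InHexagon, nbr, coord] <;> omega
      · refine three _ ht 0 1 2 ?_ ?_ ?_ <;>
          simp [IsRingTile, IsRingHole, InHexagon, nbr, coord] <;> omega
      · refine four _ ht 0 1 2 0 ?_ ?_ ?_ ?_ <;>
          simp [IsRingTile, IsRingHole, InHexagon, nbr, coord] <;> omega
    · rcases (show (i % 2 = 1 ∧ j ≤ m - 1) ∨
          (i % 2 = 0 ∧ 2 ≤ j) ∨
          (i % 2 = 1 ∧ j = m) ∨
          (i % 2 = 0 ∧ j = 1) by omega) with h' | h' | h' | h'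
      · refine two _ ht 0 2 ?_ ?_ <;>
          simp [IsRingTile, IsRingHole, InHexagon, nbr, coord] <;> omega
      · refine two _ ht 1 2 ?_ ?_ <;>
          simp [IsRingTile, IsRingHole, InHexagon, nbr, coord] <;> omega
      · refine three _ ht 0 2 1 ?_ ?_ ?_ <;>
          simp [IsRingTile, IsRingHole, InHexagon, nbr, coord] <;> omega
      · refine three _ ht 1 2 0 ?_ ?_ ?_ <;>
          simp [IsRingTile, IsRingHole, InHexagon, nbr, coord] <;> omega

end Tile

/-! ### Size and connectedness of the perforated hexagon -/

namespace Tile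

/-- The finite set of the tiles of the `m`-th hexagon. -/
noncomputable def hexagon (m : ℤ) : Finset Tile :=
  open Classical in
  ((Finset.Icc (-m) (m - 1) ×ˢ Finset.Icc (-(m - 1)) (m - 1) ×ˢ (Finset.univ : Finset Bool)).image
    fun p => (⟨p.1, p.2.1, p.2.2⟩ : Tile)).filter (InHexagon m)

theorem mem_hexagon {m : ℤ} {t : Tile} : t ∈ hexagon m ↔ InHexagon m t := by
  classical
  simp only [hexagon, Finset.mem_filter, Finset.mem_image, and_iff_right_iff_imp]
  intro h
  refine ⟨(t.i, t.j, t.up), ?_, rfl⟩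
  simp only [Finset.mem_product, Finset.mem_Icc, Finset.mem_univ, and_true]
  obtain ⟨h1, h2, h3, h4, -⟩ := h
  omega

/-- The tiles of a row of the upper half of the hexagon and those of the matching row of the lower
half together fill a row of a rectangle. -/
theorem card_hexagon {m : ℤ} (hm : 1 ≤ m) : ((hexagon m).card : ℤ) = 6 * m ^ 2 - 2 := by
  -- For `1 ≤ j ≤ m - 1`, row `j` has `4 * m - 2 * j + 1` tiles and row `j - m` has `2 * m + 2 * j +
  -- 1`, together `6 * m + 2`. Row `0` has `4 * m` tiles and remains unpaired.
  have hcard : (hexagon m).card = ((Finset.Icc 1 (m - 1) ×ˢ Finset.Icc 0 (6 * m + 1)) ∪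
      ({0} ×ˢ Finset.Icc 0 (4 * m - 1)) : Finset (ℤ × ℤ)).card := by
    refine Finset.card_nbij'
      (fun t => if t.j < 0 then (t.j + m, 2 * t.i + (if t.up then 0 else 1) + 4 * m + 2)
        else (t.j, 2 * t.i + (if t.up then 0 else 1) + 2 * m))
      (fun p => if p.1 = 0 ∨ p.2 ≤ 4 * m - 2 * p.1 then
          ⟨(p.2 - 2 * m) / 2, p.1, decide (p.2 % 2 = 0)⟩
        else ⟨(p.2 - 4 * m - 2) / 2, p.1 - m, decide (p.2 % 2 = 0)⟩) ?_ ?_ ?_ ?_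
    · rintro ⟨i, j, u⟩ h
      rw [Finset.mem_coe, mem_hexagon] at h
      rw [Finset.mem_coe]
      cases u <;> simp [InHexagon, coord] at h ⊢ <;> split_ifs <;> simp <;> omega
    · rintro ⟨a, b⟩ h
      rw [Finset.mem_coe] at h ⊢
      rw [mem_hexagon]
      simp at h
      simp only [InHexagon, coord]
      rcases Int.emod_two_eq_zero_or_one b with hb | hb <;> split_ifs <;> simp_all <;> omega
    · rintro ⟨i, j, u⟩ h
      rw [Finset.mem_coe, mem_hexagon] at h
      cases u <;> simp [InHexagon, coord] at h ⊢ <;> split_ifs <;> simp_all <;> omega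
    · rintro ⟨a, b⟩ h
      rw [Finset.mem_coe] at h
      simp at h
      dsimp only
      rcases Int.emod_two_eq_zero_or_one b with hb | hb <;> split_ifs <;> simp_all <;> omega
  rw [hcard, Finset.card_union_of_disjoint]
  · simp only [Finset.card_product, Int.card_Icc, Finset.card_singleton]
    push_cast
    rw [Int.toNat_of_nonneg (by omega), Int.toNat_of_nonneg (by omega),
      Int.toNat_of_nonneg (by omega)]
    ring
  · rw [Finset.disjoint_left]
    rintro ⟨a, b⟩ h h'
    simp at h h'
    omega

/-- The removed tiles of the `m`-th hexagon. -/
noncomputable def holeTiles (m : ℤ) : Finset Tile :=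
  open Classical in (hexagon m).filter fun t => ∃ n, 1 ≤ n ∧ n < m ∧ IsRingHole n t

/-- The tiles that remain in the `m`-th hexagon. -/
noncomputable def perforatedHexagon (m : ℤ) : Finset Tile :=
  open Classical in hexagon m \ holeTiles m

theorem mem_holeTiles {m : ℤ} {t : Tile} :
    t ∈ holeTiles m ↔ ∃ n, 1 ≤ n ∧ n < m ∧ IsRingHole n t := by
  simp only [holeTiles, Finset.mem_filter, mem_hexagon, and_iff_right_iff_imp]
  rintro ⟨n, -, h1, h2⟩
  exact h2.inHexagon.mono (by omega)

theorem mem_perforatedHexagon {m : ℤ} {t : Tile} :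
    t ∈ perforatedHexagon m ↔ InHexagon m t ∧ ∀ n, 1 ≤ n → n < m → ¬ IsRingHole n t := by
  simp [perforatedHexagon, mem_hexagon, mem_holeTiles]

theorem card_perforatedHexagon {m : ℤ} (hm : 1 ≤ m) :
    ((perforatedHexagon m).card + (holeTiles m).card : ℤ) = 6 * m ^ 2 - 2 := by
  classical
  rw [← card_hexagon hm]
  norm_cast
  exact Finset.card_sdiff_add_card_eq_card (Finset.filter_subset _ _)

theorem holeTiles_isolated {m : ℤ} {t : Tile} (ht : t ∈ holeTiles m) :
    t ∉ perforatedHexagon m ∧ ∀ d, nbr d t ∈ perforatedHexagon m := by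
  obtain ⟨n, h1, h2, h3⟩ := mem_holeTiles.1 ht
  refine ⟨fun h => (mem_perforatedHexagon.1 h).2 n h1 h2 h3, fun d => ?_⟩
  exact mem_perforatedHexagon.2 ⟨(h3.inHexagon_nbr d).mono (by omega),
    fun n' _ _ => h3.not_isRingHole_nbr n' d⟩

/-- The removed tiles of the ring around the `m`-th hexagon in cyclic order. -/
def ringHole (m i : ℤ) : Tile :=
  if 2 * i < m then ⟨m, 2 * i - m + 1, true⟩
  else if 2 * i < 2 * m - 1 then ⟨2 * m - 1 - 2 * i, 2 * i - m + 1, false⟩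
  else if 2 * i < 3 * m then ⟨2 * m - 1 - 2 * i, m, true⟩
  else if 2 * i < 4 * m then ⟨-m - 1, 4 * m - 1 - 2 * i, false⟩
  else if 2 * i < 5 * m - 1 then ⟨2 * i - 5 * m, 4 * m - 1 - 2 * i, true⟩
  else ⟨2 * i - 5 * m, -m, false⟩

theorem isRingHole_ringHole {m i : ℤ} (h0 : 0 ≤ i) (h : i < 3 * m) :
    IsRingHole m (ringHole m i) := by
  unfold ringHole
  split_ifs <;> simp [IsRingHole, InHexagon, nbr, coord] <;> omega

theorem ringHole_injective {m i i' : ℤ} (h0 : 0 ≤ i) (h : i < 3 * m)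
    (h' : i' < 3 * m) (he : ringHole m i = ringHole m i') : i = i' := by
  unfold ringHole at he
  split_ifs at he <;> simp at he <;> omega

/-- Only this inequality is proved by listing tiles; in `theorem1` equality is forced by the
fundamental inequality. -/
theorem three_mul_choose_two_le_card_holeTiles (k : ℕ) :
    3 * k.choose 2 ≤ (holeTiles k).card := by
  have hcard : ((Finset.range k).sigma fun m => Finset.range (3 * m)).card = 3 * k.choose 2 := by
    rw [Finset.card_sigma]
    simp only [Finset.card_range]
    rw [← Finset.mul_sum, Finset.sum_range_id, Nat.choose_two_right]
  rw [← hcard]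
  refine Finset.card_le_card_of_injOn (fun p => ringHole p.1 p.2) ?_ ?_
  · rintro ⟨m, i⟩ h
    obtain ⟨h1, h2⟩ : m < k ∧ i < 3 * m := by
      simpa only [Finset.mem_coe, Finset.mem_sigma, Finset.mem_range] using h
    rw [Finset.mem_coe, mem_holeTiles]
    exact ⟨m, by omega, by omega, isRingHole_ringHole (i := i) (by omega) (by omega)⟩
  · rintro ⟨m, i⟩ h ⟨m', i'⟩ h' he
    obtain ⟨h1, h2⟩ : m < k ∧ i < 3 * m := by
      simpa only [Finset.mem_coe, Finset.mem_sigma, Finset.mem_range] using h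
    obtain ⟨h1', h2'⟩ : m' < k ∧ i' < 3 * m' := by
      simpa only [Finset.mem_coe, Finset.mem_sigma, Finset.mem_range] using h'
    have hr : IsRingHole m (ringHole m i) := isRingHole_ringHole (by omega) (by omega)
    have hr' : IsRingHole m' (ringHole m' i') := isRingHole_ringHole (by omega) (by omega)
    simp only at he
    rw [he] at hr
    obtain rfl : m = m' := by exact_mod_cast IsRingHole.eq hr'.inHexagon hr'.1 hr
    have := ringHole_injective (by omega) (by omega) (by omega) he
    simp only [Sigma.mk.injEq, heq_eq_eq, true_and]
    omega

theorem isPolyiamond_perforatedHexagon {k : ℤ} (hk : 1 ≤ k) :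
    IsPolyiamond (perforatedHexagon k) := by
  have hone : ∀ {t}, InHexagon 1 t → t ∈ perforatedHexagon k := fun h =>
    mem_perforatedHexagon.2 ⟨h.mono hk, fun n hn _ hr => hr.1 (h.mono hn)⟩
  have hroot : (⟨0, 0, true⟩ : Tile) ∈ perforatedHexagon k := hone (by simp [InHexagon, coord])
  set Q : Tile → Prop := fun t => ∃ h : t ∈ perforatedHexagon k,
    (tileGraph.induce (perforatedHexagon k : Set Tile)).Reachable ⟨_, hroot⟩ ⟨t, h⟩ with hQ
  have step : ∀ t ∈ perforatedHexagon k, ∀ d, Q (nbr d t) → Q t := by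
    rintro t ht d ⟨h, hr⟩
    refine ⟨ht, hr.trans (SimpleGraph.Adj.reachable ?_)⟩
    exact adj_iff.2 ⟨d, nbr_nbr d t⟩
  -- Induction over the rings, from the four tiles of the first hexagon outwards.
  have main : ∀ n : ℕ, (n + 1 : ℤ) ≤ k → ∀ t ∈ perforatedHexagon k, InHexagon (n + 1) t → Q t := by
    intro n
    induction n with
    | zero =>
      intro _ t ht h
      have q0 : Q ⟨0, 0, true⟩ := ⟨hroot, SimpleGraph.Reachable.refl _⟩
      have q1 : Q ⟨0, 0, false⟩ := step _ (hone (by simp [InHexagon, coord])) 2 q0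
      have q2 : Q ⟨-1, 0, false⟩ := step _ (hone (by simp [InHexagon, coord])) 0 q0
      have q3 : Q ⟨-1, 0, true⟩ := step _ (hone (by simp [InHexagon, coord])) 2 q2
      obtain ⟨i, j, u⟩ := t
      have hij : j = 0 ∧ (i = 0 ∨ i = -1) := by
        simp [InHexagon] at h
        omega
      obtain ⟨rfl, rfl | rfl⟩ := hij <;> cases u <;> assumption
    | succ n ih =>
      intro hn t ht h
      push_cast at hn h
      by_cases hin : InHexagon (n + 1) t
      · exact ih (by omega) t ht hin
      have hmem : ∀ s, IsRingTile (n + 1) s → s ∈ perforatedHexagon k := by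
        rintro s ⟨h1, h2, h3⟩
        refine mem_perforatedHexagon.2 ⟨h1.mono hn, fun m _ _ hr => ?_⟩
        rw [hr.eq h1 h2] at hr
        exact h3 hr
      refine IsRingTile.induction (m := n + 1) (by omega) ?_
        (fun s hs d hd => step s (hmem s hs) d hd) t
        ⟨h, hin, (mem_perforatedHexagon.1 ht).2 _ (by omega) (by omega)⟩
      intro s hs d hd
      refine step s (hmem s hs) d (ih (by omega) _ ?_ hd)
      exact mem_perforatedHexagon.2 ⟨hd.mono (by omega),
        fun m _ _ => not_isRingHole_nbr_of_inHexagon hs.2.1 hd m⟩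
  obtain ⟨n, hn⟩ : ∃ n : ℕ, k = n + 1 := ⟨(k - 1).toNat, by omega⟩
  refine (SimpleGraph.connected_iff_exists_forall_reachable _).2 ⟨⟨_, hroot⟩, ?_⟩
  rintro ⟨t, ht⟩
  exact (main n hn.ge t ht (hn ▸ (mem_perforatedHexagon.1 ht).1)).2

end Tile

/-! ### The extremal value -/

theorem two_mul_three_mul_choose_two (k : ℕ) :
    (2 * (3 * k.choose 2) : ℤ) = 3 * k ^ 2 - 3 * k := by
  have h := Nat.choose_two_right k
  have h' := Nat.div_mul_cancel (Nat.even_mul_pred_self k).two_dvd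
  rw [← h] at h'
  rcases k with - | k
  · simp
  · rw [Nat.add_sub_cancel] at h'
    have : ((k + 1).choose 2 * 2 : ℤ) = (k + 1) * k := by exact_mod_cast h'
    push_cast
    linarith

theorem theorem1 (k : ℕ) (hk : 1 < k) :
    IsLeast (tileCounts (3 * k.choose 2)) ((9 * k ^ 2 + 3 * k - 4) / 2) := by
  have hh := two_mul_three_mul_choose_two k
  set h := 3 * k.choose 2 with hdef
  have hhcast : (3 * (k.choose 2 : ℤ)) = h := by rw [hdef]; push_cast; rfl
  rw [hhcast] at hh
  have hk' : (2 : ℤ) ≤ k := by exact_mod_cast hk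
  -- Tiles and holes together make up the full hexagon with `6 * k ^ 2 - 2` tiles.
  have hn : (((9 * k ^ 2 + 3 * k - 4) / 2 : ℕ) : ℤ) = 6 * k ^ 2 - 2 - h := by
    have h4 : 4 ≤ 9 * k ^ 2 + 3 * k := by nlinarith
    push_cast [h4]
    rw [show (9 * k ^ 2 + 3 * k - 4 : ℤ) = (6 * k ^ 2 - 2 - h) * 2 by linarith]
    simp
  generalize (9 * k ^ 2 + 3 * k - 4) / 2 = N at hn ⊢
  constructor
  · have hP := Tile.isPolyiamond_perforatedHexagon (k := k) (by omega)
    have hcard := Tile.card_perforatedHexagon (m := k) (by omega)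
    have hle := Tile.three_mul_choose_two_le_card_holeTiles k
    rw [← hdef] at hle
    obtain ⟨F, hF, hFc⟩ := exists_finset_subset_holes (S := Tile.holeTiles k)
      fun t ht => Tile.holeTiles_isolated ht
    -- With `h + 1` or more holes the perimeter after filling would be at most `6 * k - 3`, too
    -- short to enclose `6 * k ^ 2 - 2` tiles. This yields both the number of removed tiles and the
    -- absence of further holes.
    have bound : ∀ F' : Finset (Set Plane), (F' : Set (Set Plane)) ⊆
        holes (Tile.perforatedHexagon k) → (Tile.holeTiles k).card ≤ F'.card → F'.card = h := by
      intro F' hF' hc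
      obtain ⟨p, h1, h2⟩ := exists_inequality_of_subset_holes hP F' hF'
      zify at h1 h2 hc hle
      by_contra hne
      have hlt : (h : ℤ) + 1 ≤ F'.card := by
        have : h ≠ F'.card := fun e => hne e.symm
        omega
      have hp : (p : ℤ) ≤ 6 * k - 3 := by linarith
      have hp0 : (0 : ℤ) ≤ p := by positivity
      have hsq := pow_le_pow_left₀ hp0 hp 2
      linarith
    have hFh := bound F hF hFc.ge
    have hholes : (Tile.holeTiles k).card = h := by omega
    refine ⟨_, hP, le_antisymm ?_ ?_, ?_⟩
    -- Taking `h + 1` holes also covers the case of infinitely many.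
    · by_contra hlt
      rw [not_le] at hlt
      obtain ⟨S, hS, hSc⟩ := Set.exists_subset_encard_eq (Order.add_one_le_of_lt hlt)
      have hfin : S.Finite := Set.finite_of_encard_eq_coe (k := h + 1) (by rw [hSc]; norm_cast)
      have hc : hfin.toFinset.card = h + 1 := by
        have := hfin.encard_eq_coe_toFinset_card
        rw [hSc] at this
        exact_mod_cast this.symm
      have := bound hfin.toFinset (by simpa using hS) (by omega)
      omega
    · rw [← hFh, ← Set.encard_coe_eq_coe_finsetCard]
      exact Set.encard_le_encard hF
    · zify at hholes ⊢
      linarith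
  · rintro n ⟨A, hA, hAh, rfl⟩
    have hfin : (holes A).Finite := Set.finite_of_encard_eq_coe hAh
    have hc : hfin.toFinset.card = h := by
      have := hfin.encard_eq_coe_toFinset_card
      rw [hAh] at this
      exact_mod_cast this.symm
    obtain ⟨p, h1, h2⟩ := exists_inequality_of_subset_holes hA hfin.toFinset (by simp)
    rw [hc] at h1 h2
    by_contra hlt
    rw [not_le] at hlt
    zify at h1 h2 hlt
    rw [hn] at hlt
    have hp0 : (0 : ℤ) ≤ p := by positivity
    have hp : (p : ℤ) ≤ 6 * k - 1 := by linarith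
    -- This is `(p - 3) ^ 2 ≤ (6 * k - 4) ^ 2`. Eliminating the number of tiles from `h1` and `h2`
    -- gives `36 * k ^ 2 - 36 * k - 6 ≤ (p - 3) ^ 2`, hence `12 * k ≤ 22`, contrary to `2 ≤ k`.
    have hsq : (0 : ℤ) ≤ (6 * k - 1 - p) * (6 * k - 7 + p) :=
      mul_nonneg (by linarith) (by linarith)
    linarith
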